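/- For every positive integer $n$ write the harmonic number $H_n = 1+\frac12+\cdots+\frac1n$ in lowest terms as $H_n = u_n/v_n$ with $\gcd(u_n,v_n)=1$ and $v_n>0$. For a positive integer $m$ let $I_m$ be the set of positive integers $n$ such that $m\nmid v_n$, and for real $x>0$ let $I_m(x)=|I_m\cap[1,x]|$. Then for every positive integer $m$ and every positive real number $x$, $$I_m(x)\le 4\,m^{\frac13}\,x^{\frac23+\frac{1}{25\log q_m}},$$ where $q_m$ is the least prime factor of $m$ and $\log$ is the natural logarithm. (For $m=1$, which has no prime factor, $I_1$ is empty and the exponent of $x$ is read as $\frac23$.) -/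

import Mathlib

/-- The set `I_m` of positive integers `n` such that `m` does not divide `v_n`, the denominator
(in lowest terms, positive) of the harmonic number `H_n = 1 + 1/2 + ⋯ + 1/n`. -/
def harmonicNonDivSet (m : ℕ) : Set ℕ :=
  {n : ℕ | 0 < n ∧ ¬ m ∣ (harmonic n).den}

/-- The counting function `S(x) = |S ∩ [1, x]|` of a set `S` of positive integers
(a finite set for every real `x`). -/
noncomputable def countUpTo (S : Set ℕ) (x : ℝ) : ℕ :=
  (S ∩ {n : ℕ | 1 ≤ n ∧ (n : ℝ) ≤ x}).ncard

/-! If m does not divide v_n, some prime power p^e exactly dividing m does not. The terms 1/j of H_n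
with p^e ∣ j sum to p^(-e) H_⌊n/p^e⌋, and all others have valuation > -e, so ⌊n/p^e⌋ lies in the set
J of n with v_p(H_n) > 0.

J is stable under n ↦ ⌊n/p⌋, so it is counted digit by digit in base p. If n and n + d lie in J,
then p divides f'(n) for f = (X+1)⋯(X+d); hence a block of p integers has at most d - 1 such pairs
for each d < p (`card_derivative_consecutiveProd_zero_le`). A gap argument then leaves at most
e^(1/25) p^(2/3) elements of J per block (`card_block_le`, `block_bound_le_exp_mul`), whence |J ∩
[0, x]| ≤ 2 x^(2/3 + 1/(25 log p)). Summing over p ∣ m costs another factor 2. -/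

section gaps

open Finset Polynomial

/-- A set of `N` integers in `[0, y]` has many pairs at distance less than `L` when `L * N` is
large compared with `y`; each pair of consecutive elements at distance `d` counts `L - d`. -/
theorem card_mul_le_add_sum_pairs (L : ℕ) (S : Finset ℕ) :
    ∀ y, (∀ s ∈ S, s ≤ y) →
      L * #S ≤ y + L + ∑ d ∈ Ico 1 L, (L - d) * #{s ∈ S | s + d ∈ S} := by
  induction S using Finset.induction_on_max with
  | empty => intro y _; simp
  | insert a S ha ih =>
    intro y hy
    have hay : a ≤ y := hy a (mem_insert_self a S)
    have haS : a ∉ S := fun h => (ha a h).false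
    have mono : ∀ d, #{s ∈ S | s + d ∈ S} ≤ #{s ∈ insert a S | s + d ∈ insert a S} := fun d =>
      card_le_card fun s hs => by
        simp only [mem_filter, mem_insert] at hs ⊢
        exact ⟨Or.inr hs.1, Or.inr hs.2⟩
    have monoW : ∑ d ∈ Ico 1 L, (L - d) * #{s ∈ S | s + d ∈ S} ≤
        ∑ d ∈ Ico 1 L, (L - d) * #{s ∈ insert a S | s + d ∈ insert a S} :=
      sum_le_sum fun d _ => Nat.mul_le_mul_left _ (mono d)
    rw [card_insert_of_notMem haS, mul_add, mul_one]
    rcases S.eq_empty_or_nonempty with rfl | hne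
    · rw [card_empty]
      omega
    set b := S.max' hne with hb
    have hbS : b ∈ S := S.max'_mem hne
    have hba : b < a := ha b hbS
    have h1 := ih b fun s hs => S.le_max' s hs
    -- Only the consecutive pair (b, a) matters: a gap of at least L is paid by the growth of y, a
    -- shorter one by its weight L - (a - b).
    by_cases hL : L ≤ a - b
    · omega
    have hd : a - b ∈ Ico 1 L := by rw [mem_Ico]; omega
    have hnew : #{s ∈ S | s + (a - b) ∈ S} + 1 ≤
        #{s ∈ insert a S | s + (a - b) ∈ insert a S} := by
      have hb' : b ∉ ({s ∈ S | s + (a - b) ∈ S} : Finset ℕ) := by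
        simp only [mem_filter, not_and]
        intro _ h
        rw [Nat.add_sub_cancel' hba.le] at h
        exact haS h
      rw [← card_insert_of_notMem hb']
      refine card_le_card fun s hs => ?_
      simp only [mem_filter, mem_insert] at hs ⊢
      rcases hs with rfl | hs
      · exact ⟨Or.inr hbS, Or.inl (by omega)⟩
      · exact ⟨Or.inr hs.1, Or.inr hs.2⟩
    have h2 : ∑ d ∈ Ico 1 L, (L - d) * #{s ∈ S | s + d ∈ S} + (L - (a - b)) ≤
        ∑ d ∈ Ico 1 L, (L - d) * #{s ∈ insert a S | s + d ∈ insert a S} := by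
      rw [← add_sum_erase _ _ hd, ← add_sum_erase (Ico 1 L)
        (fun d => (L - d) * #{s ∈ insert a S | s + d ∈ insert a S}) hd]
      have h3 := Nat.mul_le_mul_left (L - (a - b)) hnew
      have h4 : ∑ d ∈ (Ico 1 L).erase (a - b), (L - d) * #{s ∈ S | s + d ∈ S} ≤
          ∑ d ∈ (Ico 1 L).erase (a - b), (L - d) * #{s ∈ insert a S | s + d ∈ insert a S} :=
        sum_le_sum fun d _ => Nat.mul_le_mul_left _ (mono d)
      rw [mul_add, mul_one] at h3
      omega
    omega

theorem six_mul_sum_range_sub_mul (K : ℕ) :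
    6 * ∑ i ∈ range K, (((K : ℝ) - i) * i) = (K + 1) * K * (K - 1) := by
  have h1 : ∀ n : ℕ, 2 * ∑ i ∈ range n, (i : ℝ) = n * (n - 1) := fun n => by
    induction n with
    | zero => simp
    | succ n ih => rw [sum_range_succ, mul_add, ih]; push_cast; ring
  induction K with
  | zero => simp
  | succ K ih =>
    have h2 : ∑ i ∈ range K, (((K + 1 : ℕ) : ℝ) - i) * i =
        ∑ i ∈ range K, (((K : ℝ) - i) * i) + ∑ i ∈ range K, (i : ℝ) := by
      rw [← sum_add_distrib]
      exact sum_congr rfl fun i _ => by push_cast; ring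
    rw [sum_range_succ, h2]
    have h3 := h1 K
    push_cast
    linear_combination ih + 3 * h3

/-- The sum of (L - d)(d - 1) over 1 ≤ d < L is L(L - 1)(L - 2)/6; then divide by L. -/
theorem card_le_of_card_pairs_le (S : Finset ℕ) (y L : ℕ) (hL : 0 < L) (hy : ∀ s ∈ S, s ≤ y)
    (hS : ∀ d, 0 < d → #{s ∈ S | s + d ∈ S} ≤ d - 1) :
    (#S : ℝ) ≤ 1 + y / L + ((L : ℝ) - 1) * (L - 2) / 6 := by
  obtain ⟨K, rfl⟩ : ∃ K, L = K + 1 := ⟨L - 1, by omega⟩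
  have h1 := card_mul_le_add_sum_pairs (K + 1) S y hy
  have h2 : ∑ d ∈ Ico 1 (K + 1), (K + 1 - d) * #{s ∈ S | s + d ∈ S} ≤
      ∑ d ∈ Ico 1 (K + 1), (K + 1 - d) * (d - 1) :=
    sum_le_sum fun d hd => Nat.mul_le_mul_left _ (hS d (mem_Ico.1 hd).1)
  have h3 : ((∑ d ∈ Ico 1 (K + 1), (K + 1 - d) * (d - 1) : ℕ) : ℝ) =
      ∑ i ∈ range K, (((K : ℝ) - i) * i) := by
    rw [sum_Ico_eq_sum_range]
    push_cast
    refine sum_congr (by simp) fun i hi => ?_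
    have hi : i < K := by simpa using hi
    rw [show K + 1 - (1 + i) = K - i by omega, show 1 + i - 1 = i by omega, Nat.cast_sub hi.le]
  have h4 := six_mul_sum_range_sub_mul K
  have h5 : (((K + 1) * #S : ℕ) : ℝ) ≤
      (y + (K + 1) + ∑ d ∈ Ico 1 (K + 1), (K + 1 - d) * (d - 1) : ℕ) := by
    exact_mod_cast h1.trans (by omega)
  rw [Nat.cast_add, h3] at h5
  push_cast at h5 ⊢
  have hK : (0 : ℝ) < K + 1 := by positivity
  rw [← mul_le_mul_iff_right₀ hK]
  have h6 : ((K : ℝ) + 1) * (1 + y / (K + 1) + (K + 1 - 1) * (K + 1 - 2) / 6) =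
    K + 1 + y + (K + 1) * K * (K - 1) / 6 := by field_simp; ring
  rw [h6]
  linarith

/-! ### Pairs at distance d as roots of a polynomial mod p -/

/-- The polynomial `(X + 1)(X + 2)⋯(X + d)`. -/
noncomputable def consecutiveProd (d : ℕ) : ℤ[X] := ∏ j ∈ range d, (X + C ((j : ℤ) + 1))

theorem monic_consecutiveProd (d : ℕ) : (consecutiveProd d).Monic :=
  monic_prod_of_monic _ _ fun _ _ => monic_X_add_C _

theorem natDegree_consecutiveProd (d : ℕ) : (consecutiveProd d).natDegree = d := by
  rw [consecutiveProd, natDegree_prod_of_monic _ _ fun _ _ => monic_X_add_C _]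
  simp only [natDegree_X_add_C, sum_const, card_range, smul_eq_mul, mul_one]

/-- Mod p the derivative has leading coefficient d ≠ 0, hence at most d - 1 roots. -/
theorem card_derivative_consecutiveProd_zero_le (p : ℕ) [Fact p.Prime] (d q : ℕ) (hd : 0 < d)
    (hdp : d < p) :
    #{r ∈ range p | (p : ℤ) ∣ (derivative (consecutiveProd d)).eval ((q * p + r : ℕ) : ℤ)} ≤
      d - 1 := by
  set Q := (consecutiveProd d).map (Int.castRingHom (ZMod p)) with hQ
  have hm : Q.Monic := (monic_consecutiveProd d).map _
  have hdeg : Q.natDegree = d := by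
    rw [hQ, (monic_consecutiveProd d).natDegree_map, natDegree_consecutiveProd]
  have hne : derivative Q ≠ 0 := by
    intro h
    have h1 : (derivative Q).coeff (d - 1) = 0 := by rw [h, coeff_zero]
    rw [coeff_derivative, Nat.sub_add_cancel hd, ← hdeg, hm.coeff_natDegree, hdeg, one_mul,
      ← Nat.cast_add_one, Nat.sub_add_cancel hd, ZMod.natCast_eq_zero_iff] at h1
    exact absurd (Nat.le_of_dvd hd h1) (by omega)
  have hlt : (derivative Q).natDegree ≤ d - 1 := hdeg ▸ natDegree_derivative_le Q
  refine le_trans ?_ ((Multiset.toFinset_card_le _).trans ((card_roots' (derivative Q)).trans hlt))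
  refine card_le_card_of_injOn (fun r => (r : ZMod p)) (fun r hr => ?_) fun r hr s hs h => ?_
  · simp only [coe_filter, Set.mem_ofPred_eq, mem_range] at hr
    simp only [mem_coe, Multiset.mem_toFinset, mem_roots hne, IsRoot.def]
    have h := (ZMod.intCast_zmod_eq_zero_iff_dvd _ p).2 hr.2
    rw [hQ, derivative_map, ← h, ← eq_intCast (Int.castRingHom (ZMod p)), ← eval₂_hom,
      ← eval_map]
    simp
  · simp only [coe_filter, Set.mem_ofPred_eq, mem_range] at hr hs
    have := (ZMod.natCast_eq_natCast_iff' r s p).1 h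
    rwa [Nat.mod_eq_of_lt hr.1, Nat.mod_eq_of_lt hs.1] at this

/-- Logarithmic derivative: f'/f at n is the sum of 1/(n + j) for 1 ≤ j ≤ d. -/
theorem eval_derivative_consecutiveProd {K : Type*} [Field K] [CharZero K] (d n : ℕ) :
    (((derivative (consecutiveProd d)).eval (n : ℤ) : ℤ) : K) =
      ((consecutiveProd d).eval (n : ℤ) : ℤ) * ((harmonic (n + d) : ℚ) - (harmonic n : ℚ) : ℚ) := by
  induction d with
  | zero => simp [consecutiveProd]
  | succ d ih =>
    have h : consecutiveProd (d + 1) = consecutiveProd d * (X + C ((d : ℤ) + 1)) :=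
      prod_range_succ _ _
    have h0 : (n : K) + d + 1 ≠ 0 := by exact_mod_cast Nat.succ_ne_zero (n + d)
    rw [h, derivative_mul, ← add_assoc, harmonic_succ]
    simp only [eval_add, eval_mul, eval_X, eval_C, derivative_add, derivative_X, derivative_C,
      eval_one, eval_zero]
    push_cast at ih ⊢
    rw [ih]
    field_simp
    ring

/-- The set of `n ≥ 0` such that `H_n` has positive `p`-adic valuation; it contains `0`. -/
def padicHarmonicSet (p : ℕ) [Fact p.Prime] : Set ℕ :=
  {n | ‖((harmonic n : ℚ) : ℚ_[p])‖ < 1}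

/-! ### p-adic size of harmonic numbers -/

section padic

variable {p : ℕ} [hp : Fact p.Prime]

theorem inv_pow_lt_norm_natCast {e n : ℕ} (h : ¬ p ^ e ∣ n) :
    ((p : ℝ) ^ e)⁻¹ < ‖(n : ℚ_[p])‖ := by
  by_contra! hle
  have h1 : ‖((n : ℤ) : ℚ_[p])‖ ≤ (p : ℝ) ^ (-(e : ℤ)) := by
    rw [zpow_neg, zpow_natCast]; exact_mod_cast hle
  rw [Padic.norm_int_le_pow_iff_dvd] at h1
  exact h (by exact_mod_cast h1)

theorem norm_ratCast_lt_of_not_dvd_den {e : ℕ} {q : ℚ} (h : ¬ p ^ e ∣ q.den) :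
    ‖(q : ℚ_[p])‖ < (p : ℝ) ^ e := by
  have hp0 : (0 : ℝ) < (p : ℝ) ^ e := by have := hp.out.pos; positivity
  have h1 := inv_pow_lt_norm_natCast h
  have h2 : (0 : ℝ) < ‖(q.den : ℚ_[p])‖ := (inv_pos.2 hp0).trans h1
  rw [Rat.cast_def, norm_div, div_lt_iff₀ h2]
  calc ‖(q.num : ℚ_[p])‖ ≤ 1 := Padic.norm_int_le_one _
    _ = (p : ℝ) ^ e * ((p : ℝ) ^ e)⁻¹ := (mul_inv_cancel₀ hp0.ne').symm
    _ < _ := mul_lt_mul_of_pos_left h1 hp0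

theorem norm_harmonic_sub_lt (e n : ℕ) :
    ‖((harmonic n - ((p : ℚ) ^ e)⁻¹ * harmonic (n / p ^ e) : ℚ) : ℚ_[p])‖ < (p : ℝ) ^ e := by
  have hp0 : 0 < p ^ e := pow_pos hp.out.pos e
  have hpR : (0 : ℝ) < (p : ℝ) ^ e := by exact_mod_cast hp0
  induction n with
  | zero => simpa using hpR
  | succ n ih =>
    rw [Nat.succ_div, harmonic_succ]
    split_ifs with h
    · obtain ⟨c, hc⟩ := h
      have hq : n / p ^ e + 1 = c := by
        have := Nat.succ_div_of_dvd (a := n) (b := p ^ e) ⟨c, hc⟩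
        rw [← this, hc, Nat.mul_div_cancel_left _ hp0]
      have h1 : ((p : ℚ) ^ e)⁻¹ * ((n / p ^ e + 1 : ℕ) : ℚ)⁻¹ = ((n + 1 : ℕ) : ℚ)⁻¹ := by
        rw [hc, hq, ← mul_inv]; push_cast; rfl
      rw [harmonic_succ, mul_add, h1]
      convert ih using 3
      ring
    · have h1 : ‖(((n + 1 : ℕ) : ℚ_[p]))⁻¹‖ < (p : ℝ) ^ e := by
        rw [norm_inv]
        exact inv_lt_of_inv_lt₀ hpR (inv_pow_lt_norm_natCast h)
      rw [add_zero, add_sub_right_comm, Rat.cast_add, Rat.cast_inv, Rat.cast_natCast]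
      exact (Padic.nonarchimedean _ _).trans_lt (max_lt ih h1)

theorem div_pow_mem_padicHarmonicSet {e n : ℕ}
    (h : ‖((harmonic n : ℚ) : ℚ_[p])‖ < (p : ℝ) ^ e) : n / p ^ e ∈ padicHarmonicSet p := by
  have hpR : (0 : ℝ) < (p : ℝ) ^ e := by have := hp.out.pos; positivity
  have h1 := norm_harmonic_sub_lt (p := p) e n
  have h2 : ‖(((((p : ℚ) ^ e)⁻¹ * harmonic (n / p ^ e) : ℚ)) : ℚ_[p])‖ < (p : ℝ) ^ e := by
    have h3 : (((p : ℚ) ^ e)⁻¹ * harmonic (n / p ^ e) : ℚ) = harmonic n +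
      -(harmonic n - ((p : ℚ) ^ e)⁻¹ * harmonic (n / p ^ e)) := by ring
    rw [h3, Rat.cast_add, Rat.cast_neg]
    exact (Padic.nonarchimedean _ _).trans_lt (max_lt h (by rwa [norm_neg]))
  rw [Rat.cast_mul, Rat.cast_inv, Rat.cast_pow, Rat.cast_natCast, norm_mul, norm_inv, norm_pow,
    Padic.norm_p, inv_pow, inv_inv] at h2
  exact lt_of_mul_lt_mul_left (by rwa [mul_one]) hpR.le

theorem div_mem_padicHarmonicSet {n : ℕ} (h : n ∈ padicHarmonicSet p) :
    n / p ∈ padicHarmonicSet p := by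
  have h1 : ‖((harmonic n : ℚ) : ℚ_[p])‖ < (p : ℝ) ^ 1 := by
    rw [pow_one]
    exact lt_trans h (by exact_mod_cast hp.out.one_lt)
  simpa using div_pow_mem_padicHarmonicSet h1

theorem dvd_eval_derivative_of_mem_padicHarmonicSet {n d : ℕ} (h : n ∈ padicHarmonicSet p)
    (hd : n + d ∈ padicHarmonicSet p) :
    (p : ℤ) ∣ (derivative (consecutiveProd d)).eval (n : ℤ) := by
  rw [← Padic.norm_intCast_lt_one_iff, eval_derivative_consecutiveProd, norm_mul]
  have h1 : ‖((harmonic (n + d) - harmonic n : ℚ) : ℚ_[p])‖ < 1 := by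
    rw [sub_eq_add_neg, Rat.cast_add, Rat.cast_neg]
    exact (Padic.nonarchimedean _ _).trans_lt (max_lt hd (by rw [norm_neg]; exact h))
  exact (mul_le_of_le_one_left (norm_nonneg _) (Padic.norm_int_le_one _)).trans_lt h1

open Classical in
theorem card_block_le (q y L : ℕ) (hL : 0 < L) (hy : y < p) :
    (#{r ∈ range (y + 1) | q * p + r ∈ padicHarmonicSet p} : ℝ) ≤
      1 + y / L + ((L : ℝ) - 1) * (L - 2) / 6 := by
  refine card_le_of_card_pairs_le _ y L hL (fun s hs => ?_) fun d hd => ?_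
  · have := (mem_filter.1 hs).1
    rw [mem_range] at this
    omega
  by_cases hdp : d < p
  · refine (card_le_card fun s hs => ?_).trans
      (card_derivative_consecutiveProd_zero_le p d q hd hdp)
    simp only [mem_filter, mem_range] at hs ⊢
    exact ⟨by omega, dvd_eval_derivative_of_mem_padicHarmonicSet hs.1.2
      (by rw [add_assoc]; exact hs.2.2)⟩
  -- The block has y + 1 ≤ p elements, so no two are at distance d ≥ p.
  · rw [filter_false_of_mem, card_empty]
    · exact Nat.zero_le _
    · intro s _ hs
      have := mem_range.1 (mem_filter.1 hs).1
      omega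

end padic

end gaps

/-! ### Real estimates -/

section estimates

open Real

/-- With y = t³/3, the main part y/L + L²/6 is least at L = t; rounding up is harmless. -/
theorem exists_block_bound_le {t : ℝ} (ht : 0 < t) :
    ∃ L : ℕ, 0 < L ∧
      1 + t ^ 3 / 3 / L + ((L : ℝ) - 1) * (L - 2) / 6 ≤ t ^ 2 / 2 - t / 2 + 4 / 3 := by
  have hL : 0 < ⌈t⌉₊ := Nat.ceil_pos.2 ht
  refine ⟨⌈t⌉₊, hL, ?_⟩
  have h1 : t ≤ ⌈t⌉₊ := Nat.le_ceil t
  have h2 : (⌈t⌉₊ : ℝ) < t + 1 := Nat.ceil_lt_add_one ht.le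
  set l : ℝ := ((⌈t⌉₊ : ℕ) : ℝ) with hl
  have hl0 : 0 < l := by rw [hl]; exact_mod_cast hL
  obtain ⟨u, hu⟩ : ∃ u, l = t + u := ⟨l - t, by ring⟩
  have hu0 : 0 ≤ u := by linarith
  have hu1 : u ≤ 1 := by linarith
  have h3 : t ^ 3 / 3 / l ≤ (t ^ 2 - t * u + u ^ 2) / 3 := by
    rw [div_le_iff₀ hl0, hu]
    have : 0 ≤ u ^ 3 := by positivity
    nlinarith
  have h4 : u ^ 2 ≤ u := by nlinarith
  rw [hu] at h3 ⊢
  nlinarith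

theorem block_bound_le_two_mul {y : ℝ} (hy : 1 ≤ y) :
    ∃ L : ℕ, 0 < L ∧
      1 + y / L + ((L : ℝ) - 1) * (L - 2) / 6 ≤ 2 * y ^ ((2 : ℝ) / 3) := by
  have hy0 : 0 < 3 * y := by linarith
  obtain ⟨t, ht, ht3⟩ : ∃ t : ℝ, 0 < t ∧ t ^ 3 = 3 * y :=
    ⟨(3 * y) ^ ((1 : ℝ) / 3), by positivity, by
      rw [← rpow_natCast, ← rpow_mul hy0.le]; norm_num⟩
  obtain ⟨L, hL, h⟩ := exists_block_bound_le ht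
  refine ⟨L, hL, ?_⟩
  rw [ht3, mul_div_cancel_left₀ _ three_ne_zero] at h
  refine h.trans ?_
  have ht1 : 1.44 ≤ t := by
    by_contra! hlt
    have : t ^ 3 < 1.44 ^ 3 := pow_lt_pow_left₀ hlt ht.le (by norm_num)
    norm_num at this
    linarith
  set z := y ^ ((2 : ℝ) / 3) with hz
  have hz0 : 0 ≤ z := by positivity
  have hz3 : z ^ 3 = y ^ 2 := by
    rw [hz, ← rpow_natCast, ← rpow_mul (by linarith)]; norm_num
  have h5 : 0.48 * t ^ 2 ≤ z := by
    refine le_of_pow_le_pow_left₀ three_ne_zero hz0 ?_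
    have h6 : (0.48 * t ^ 2) ^ 3 = 0.48 ^ 3 * (t ^ 3) ^ 2 := by ring
    rw [h6, ht3, hz3]
    nlinarith [sq_nonneg y]
  nlinarith

theorem block_bound_le_exp_mul {p : ℕ} (hp : p.Prime) :
    ∃ L : ℕ, 0 < L ∧
      1 + ((p : ℝ) - 1) / L + ((L : ℝ) - 1) * (L - 2) / 6 ≤
        exp (1 / 25) * (p : ℝ) ^ ((2 : ℝ) / 3) := by
  set M := exp (1 / 25) * (p : ℝ) ^ ((2 : ℝ) / 3) with hM
  have hp0 : (0 : ℝ) < p := by exact_mod_cast hp.pos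
  have hM0 : 0 ≤ M := by positivity
  have hM3 : (9 / 8 : ℝ) * p ^ 2 ≤ M ^ 3 := by
    have h1 : M ^ 3 = exp (3 / 25) * (p : ℝ) ^ 2 := by
      rw [hM, mul_pow, ← exp_nat_mul, ← rpow_natCast (_ ^ _), ← rpow_mul hp0.le]; norm_num
    rw [h1]
    -- This fixes the constant 1/25: for t³ = 3p one has (t²/2)³ = (9/8) p².
    have h2 : (9 / 8 : ℝ) ≤ exp (3 / 25) := by
      have := quadratic_le_exp_of_nonneg (show (0 : ℝ) ≤ 3 / 25 by norm_num)
      norm_num at this ⊢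
      linarith
    gcongr
  have key : ∀ c : ℝ, c ^ 3 ≤ 9 / 8 * (p : ℝ) ^ 2 → c ≤ M := fun c hc =>
    le_of_pow_le_pow_left₀ three_ne_zero hM0 (hc.trans hM3)
  by_cases h7 : 7 ≤ p
  · have hp7 : (7 : ℝ) ≤ p := by exact_mod_cast h7
    have hy0 : (0 : ℝ) < 3 * p := by positivity
    obtain ⟨t, ht, ht3⟩ : ∃ t : ℝ, 0 < t ∧ t ^ 3 = 3 * p :=
      ⟨(3 * (p : ℝ)) ^ ((1 : ℝ) / 3), by positivity, by
        rw [← rpow_natCast, ← rpow_mul hy0.le]; norm_num⟩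
    obtain ⟨L, hL, h⟩ := exists_block_bound_le ht
    refine ⟨L, hL, ?_⟩
    rw [ht3, mul_div_cancel_left₀ _ three_ne_zero] at h
    -- From here on -t/2 + 4/3 ≤ 0. This fails at p = 5, so smaller primes are checked by hand.
    have ht1 : 8 / 3 ≤ t := by
      by_contra! hlt
      have : t ^ 3 < (8 / 3) ^ 3 := pow_lt_pow_left₀ hlt ht.le (by norm_num)
      norm_num at this
      linarith
    have h8 : t ^ 2 / 2 ≤ M := by
      refine key _ (le_of_eq ?_)
      have : (t ^ 2 / 2) ^ 3 = (t ^ 3) ^ 2 / 8 := by ring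
      rw [this, ht3]; ring
    have h9 : ((p : ℝ) - 1) / L ≤ p / L := by gcongr; linarith
    linarith
  · have h2 := hp.two_le
    interval_cases p
    · exact ⟨2, by norm_num, key _ (by norm_num)⟩
    · exact ⟨2, by norm_num, key _ (by norm_num)⟩
    · exact absurd hp (by norm_num)
    · exact ⟨3, by norm_num, key _ (by norm_num)⟩
    · exact absurd hp (by norm_num)

theorem pow_three_le_two_pow_add_two (k : ℕ) : k ^ 3 ≤ 2 ^ (k + 2) := by
  by_cases hk : k < 6
  · interval_cases k <;> norm_num
  · push Not at hk
    induction k, hk using Nat.le_induction with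
    | base => norm_num
    | succ k hk ih =>
      rw [show k + 1 + 2 = (k + 2) + 1 by ring, pow_succ 2]
      nlinarith [mul_le_mul hk hk (by norm_num) (by omega)]

/-- With k primes, the k - 1 other prime powers are each at least 2, so every term is at most
(m/2^(k-1))^(1/3); and k³ ≤ 8 · 2^(k-1). -/
theorem sum_ordProj_rpow_le (m : ℕ) (hm : m ≠ 0) :
    ∑ p ∈ m.primeFactors, ((p ^ m.factorization p : ℕ) : ℝ) ^ ((1 : ℝ) / 3) ≤
      2 * (m : ℝ) ^ ((1 : ℝ) / 3) := by
  set k := m.primeFactors.card with hk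
  have hm0 : (0 : ℝ) < m := by exact_mod_cast Nat.pos_of_ne_zero hm
  have h1 : ∀ p ∈ m.primeFactors, p ^ m.factorization p * 2 ^ (k - 1) ≤ m := fun p hp => by
    conv_rhs => rw [← Nat.prod_factorization_pow_eq_self hm,
      Nat.prod_factorization_eq_prod_primeFactors, ← Finset.mul_prod_erase _ _ hp]
    refine Nat.mul_le_mul_left _ ?_
    rw [hk, ← Finset.card_erase_of_mem hp]
    refine Finset.pow_card_le_prod _ _ _ fun q hq => ?_
    have hq' := Finset.mem_of_mem_erase hq
    have hqp := Nat.prime_of_mem_primeFactors hq'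
    exact hqp.two_le.trans (Nat.le_self_pow
      (hqp.factorization_pos_of_dvd hm (Nat.dvd_of_mem_primeFactors hq')).ne' q)
  have h2 : ∀ p ∈ m.primeFactors, ((p ^ m.factorization p : ℕ) : ℝ) ^ ((1 : ℝ) / 3) ≤
      ((m : ℝ) / 2 ^ (k - 1)) ^ ((1 : ℝ) / 3) := fun p hp => by
    refine rpow_le_rpow (Nat.cast_nonneg _) ?_ (by norm_num)
    rw [le_div_iff₀ (by positivity)]
    exact_mod_cast h1 p hp
  refine (Finset.sum_le_card_nsmul _ _ _ h2).trans ?_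
  rw [nsmul_eq_mul, ← hk]
  refine le_of_pow_le_pow_left₀ three_ne_zero (by positivity) ?_
  rw [mul_pow, mul_pow, ← rpow_natCast (_ ^ _), ← rpow_natCast ((m : ℝ) ^ _),
    ← rpow_mul (by positivity), ← rpow_mul hm0.le]
  norm_num
  have h3 : (k : ℝ) ^ 3 ≤ 8 * 2 ^ (k - 1) := by
    rcases Nat.eq_zero_or_pos k with h | h
    · rw [h]; norm_num
    · have := pow_three_le_two_pow_add_two k
      rw [show k + 2 = (k - 1) + 3 by omega, pow_add] at this
      have h' : (k : ℝ) ^ 3 ≤ 2 ^ (k - 1) * 2 ^ 3 := by exact_mod_cast this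
      linarith
  rw [mul_div_assoc', div_le_iff₀ (by positivity)]
  nlinarith

end estimates

open Finset Real

/-! ### Counting by base-p digits -/

section counting

variable {p : ℕ} [hp : Fact p.Prime]

theorem card_filter_range_le_card_image_div_mul (S U : Finset ℕ) {b : ℕ} {M : ℝ}
    (hSU : ∀ n ∈ S, n / b ∈ U) (hM : ∀ q ∈ U, (#{n ∈ S | n / b = q} : ℝ) ≤ M) :
    (#S : ℝ) ≤ #U * M := by
  rw [card_eq_sum_card_fiberwise (f := fun n => n / b) (t := U) hSU, Nat.cast_sum, ← nsmul_eq_mul]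
  exact sum_le_card_nsmul _ _ _ hM

open Classical in
theorem card_padicHarmonicSet_range_mul_le {N : ℕ} :
    (#{n ∈ range (N * p) | n ∈ padicHarmonicSet p} : ℝ) ≤
      #{n ∈ range N | n ∈ padicHarmonicSet p} * (exp (1 / 25) * (p : ℝ) ^ ((2 : ℝ) / 3)) := by
  have hp0 := hp.out.pos
  refine card_filter_range_le_card_image_div_mul (b := p) _ _ (fun n hn => ?_) fun q _ => ?_
  · simp only [mem_filter, mem_range] at hn ⊢
    exact ⟨Nat.div_lt_of_lt_mul (by rw [mul_comm]; exact hn.1), div_mem_padicHarmonicSet hn.2⟩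
  · obtain ⟨L, hL, h⟩ := block_bound_le_exp_mul hp.out
    have h1 := card_block_le (p := p) q (p - 1) L hL (by omega)
    rw [Nat.cast_sub hp0, Nat.cast_one, Nat.sub_add_cancel hp0] at h1
    refine le_trans ?_ (h1.trans h)
    rw [Nat.cast_le]
    refine card_le_card_of_injOn (fun n => n % p) (fun n hn => ?_) fun n hn n' hn' h => ?_
    · simp only [coe_filter, mem_filter, mem_range, Set.mem_ofPred_eq] at hn ⊢
      refine ⟨Nat.mod_lt _ hp0, ?_⟩
      rw [← hn.2, Nat.div_add_mod']
      exact hn.1.2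
    · simp only [coe_filter, mem_filter, mem_range, Set.mem_ofPred_eq] at hn hn' h
      rw [← Nat.div_add_mod' n p, ← Nat.div_add_mod' n' p, hn.2, hn'.2, h]

open Classical in
theorem card_padicHarmonicSet_range_mul_pow_le {y : ℕ} (hy : 1 ≤ y) (hyp : y < p) (k : ℕ) :
    (#{n ∈ range ((y + 1) * p ^ k) | n ∈ padicHarmonicSet p} : ℝ) ≤
      2 * (y : ℝ) ^ ((2 : ℝ) / 3) * (exp (1 / 25) * (p : ℝ) ^ ((2 : ℝ) / 3)) ^ k := by
  induction k with
  | zero =>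
    obtain ⟨L, hL, h⟩ := block_bound_le_two_mul (y := y) (by exact_mod_cast hy)
    have h1 := (card_block_le (p := p) 0 y L hL hyp).trans h
    simpa using h1
  | succ k ih =>
    rw [pow_succ, ← mul_assoc, pow_succ, ← mul_assoc]
    refine card_padicHarmonicSet_range_mul_le.trans ?_
    gcongr

open Classical in
theorem card_padicHarmonicSet_le {x : ℝ} (hx : 1 ≤ x) :
    (#{n ∈ range (⌊x⌋₊ + 1) | n ∈ padicHarmonicSet p} : ℝ) ≤
      2 * x ^ ((2 : ℝ) / 3 + 1 / (25 * log (p : ℝ))) := by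
  have hX : ⌊x⌋₊ ≠ 0 := (Nat.floor_pos.2 hx).ne'
  have hp1 := hp.out.one_lt
  have hpR : (1 : ℝ) < p := by exact_mod_cast hp1
  have hlog : 0 < log (p : ℝ) := log_pos hpR
  set k := Nat.log p ⌊x⌋₊ with hk
  set y := ⌊x⌋₊ / p ^ k with hy
  have hpk : 0 < p ^ k := pow_pos hp.out.pos k
  have hy1 : 1 ≤ y := (Nat.one_le_div_iff hpk).2 (Nat.pow_log_le_self p hX)
  have hyp : y < p := by
    refine Nat.div_lt_of_lt_mul ?_
    rw [← pow_succ]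
    exact Nat.lt_pow_succ_log_self hp1 _
  have hle : ((y * p ^ k : ℕ) : ℝ) ≤ x :=
    (Nat.cast_le.2 (Nat.div_mul_le_self _ _)).trans (Nat.floor_le (by linarith))
  have hlt : ⌊x⌋₊ + 1 ≤ (y + 1) * p ^ k := by
    rw [mul_comm]
    exact Nat.lt_mul_div_succ _ hpk
  have hy1R : (1 : ℝ) ≤ y := by exact_mod_cast hy1
  set a := (2 : ℝ) / 3 + 1 / (25 * log (p : ℝ)) with ha
  have ha0 : (2 : ℝ) / 3 ≤ a := by rw [ha]; have : 0 < 1 / (25 * log (p : ℝ)) := by positivity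
                                   linarith
  -- The exponent is chosen so that each digit costs exactly p^a.
  have hpa : (p : ℝ) ^ a = exp (1 / 25) * (p : ℝ) ^ ((2 : ℝ) / 3) := by
    rw [ha, rpow_add (by linarith), mul_comm, rpow_def_of_pos (by linarith) (1 / _)]
    congr 2
    field_simp
  calc (#{n ∈ range (⌊x⌋₊ + 1) | n ∈ padicHarmonicSet p} : ℝ)
      ≤ #{n ∈ range ((y + 1) * p ^ k) | n ∈ padicHarmonicSet p} := by
        rw [Nat.cast_le]
        exact card_le_card (filter_subset_filter _ (range_subset_range.2 hlt))
    _ ≤ 2 * (y : ℝ) ^ ((2 : ℝ) / 3) * (exp (1 / 25) * (p : ℝ) ^ ((2 : ℝ) / 3)) ^ k :=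
        card_padicHarmonicSet_range_mul_pow_le hy1 hyp k
    _ ≤ 2 * (y : ℝ) ^ a * ((p : ℝ) ^ a) ^ k := by
        rw [hpa]
        gcongr
    _ = 2 * ((y * p ^ k : ℕ) : ℝ) ^ a := by
        rw [Nat.cast_mul, Nat.cast_pow, mul_rpow (by positivity) (by positivity), mul_assoc,
          ← rpow_natCast, ← rpow_natCast, ← rpow_mul (by positivity), ← rpow_mul (by positivity),
          mul_comm (k : ℝ)]
    _ ≤ 2 * x ^ a := by gcongr

theorem card_not_prime_pow_dvd_den_le {e : ℕ} {x : ℝ} (hx : 1 ≤ x) :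
    (#{n ∈ Icc 1 ⌊x⌋₊ | ¬ p ^ e ∣ (harmonic n).den} : ℝ) ≤
      2 * ((p ^ e : ℕ) : ℝ) ^ ((1 : ℝ) / 3) *
        x ^ ((2 : ℝ) / 3 + 1 / (25 * log (p : ℝ))) := by
  classical
  have hpR : (1 : ℝ) < p := by exact_mod_cast hp.out.one_lt
  have hlog : 0 < log (p : ℝ) := log_pos hpR
  have hb : 0 < p ^ e := pow_pos hp.out.pos e
  have hx0 : 0 < x := by linarith
  have hα := card_padicHarmonicSet_le (p := p) (x := x / (p ^ e : ℕ))
  set a := (2 : ℝ) / 3 + 1 / (25 * log (p : ℝ)) with ha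
  have ha0 : (2 : ℝ) / 3 ≤ a := by
    rw [ha]
    have : 0 < 1 / (25 * log (p : ℝ)) := by positivity
    linarith
  have hbR : (1 : ℝ) ≤ (p ^ e : ℕ) := by exact_mod_cast hb
  set b := p ^ e with hbdef
  -- For x < b the trivial bound x = x^(1/3) x^(2/3) suffices.
  rcases lt_or_ge x b with h | h
  · calc (#{n ∈ Icc 1 ⌊x⌋₊ | ¬ b ∣ (harmonic n).den} : ℝ) ≤ ⌊x⌋₊ := by
          rw [Nat.cast_le]
          exact (card_filter_le _ _).trans (by simp)
      _ ≤ x := Nat.floor_le hx0.le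
      _ = x ^ ((1 : ℝ) / 3) * x ^ ((2 : ℝ) / 3) := by rw [← rpow_add hx0]; norm_num
      _ ≤ (b : ℝ) ^ ((1 : ℝ) / 3) * x ^ a := by gcongr
      _ ≤ _ := by
          rw [mul_assoc]
          have : 0 ≤ (b : ℝ) ^ ((1 : ℝ) / 3) * x ^ a := by positivity
          linarith
  · have hb0 : (0 : ℝ) < b := by linarith
    have h1 : (#{n ∈ Icc 1 ⌊x⌋₊ | ¬ b ∣ (harmonic n).den} : ℝ) ≤
        #{n ∈ range (⌊x / b⌋₊ + 1) | n ∈ padicHarmonicSet p} * (b : ℝ) := by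
      refine card_filter_range_le_card_image_div_mul (b := b) _ _ (fun n hn => ?_) fun q _ => ?_
      · simp only [mem_filter, mem_range, mem_Icc] at hn ⊢
        refine ⟨?_, div_pow_mem_padicHarmonicSet (norm_ratCast_lt_of_not_dvd_den hn.2)⟩
        rw [Nat.floor_div_natCast]
        exact Nat.lt_succ_of_le (Nat.div_le_div_right hn.1.2)
      · rw [Nat.cast_le]
        conv_rhs => rw [← card_range b]
        refine card_le_card_of_injOn (fun n => n % b) (fun n hn => ?_) fun n hn n' hn' h => ?_
        · exact mem_coe.2 (mem_range.2 (Nat.mod_lt _ hb))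
        · simp only [coe_filter, mem_filter, Set.mem_ofPred_eq] at hn hn' h
          rw [← Nat.div_add_mod' n b, ← Nat.div_add_mod' n' b, hn.2, hn'.2, h]
    calc _ ≤ _ := h1
      _ ≤ 2 * (x / b) ^ a * b := by
          gcongr
          exact hα ((one_le_div hb0).2 h)
      _ = 2 * (b : ℝ) ^ (1 - a) * x ^ a := by
          rw [div_rpow hx0.le hb0.le, rpow_sub hb0, rpow_one]
          ring
      _ ≤ _ := by
          gcongr 2 * ?_ * _
          -- 1 - a ≤ 1/3.
          exact rpow_le_rpow_of_exponent_le hbR (by linarith)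

end counting

theorem exists_primeFactor_not_ordProj_dvd {m d : ℕ} (hm : m ≠ 0) (hd : d ≠ 0) (h : ¬ m ∣ d) :
    ∃ p ∈ m.primeFactors, ¬ p ^ m.factorization p ∣ d := by
  by_contra! hall
  refine h ((Nat.factorization_prime_le_iff_dvd hm hd).1 fun p hp => ?_)
  by_cases hpm : p ∈ m.primeFactors
  · exact (hp.pow_dvd_iff_le_factorization hd).1 (hall p hpm)
  · rw [← Nat.support_factorization, Finsupp.notMem_support_iff] at hpm
    rw [hpm]
    exact Nat.zero_le _

theorem countUpTo_eq_card (m : ℕ) (x : ℝ) (hx : 0 ≤ x) :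
    countUpTo (harmonicNonDivSet m) x = #{n ∈ Icc 1 ⌊x⌋₊ | ¬ m ∣ (harmonic n).den} := by
  rw [countUpTo, ← Set.ncard_coe_finset]
  congr 1
  ext n
  simp only [harmonicNonDivSet, Set.mem_inter_iff, Set.mem_ofPred_eq, coe_filter, mem_Icc,
    Nat.le_floor_iff hx]
  constructor
  · rintro ⟨⟨_, h⟩, h'⟩
    exact ⟨h', h⟩
  · rintro ⟨h', h⟩
    exact ⟨⟨h'.1, h⟩, h'⟩

theorem theorem2 (m : ℕ) (hm : 0 < m) (x : ℝ) (hx : 0 < x) :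
    (countUpTo (harmonicNonDivSet m) x : ℝ) ≤
      4 * (m : ℝ) ^ ((1 : ℝ) / 3) *
        x ^ ((2 : ℝ) / 3 + 1 / (25 * Real.log (m.minFac : ℝ))) := by
  rw [countUpTo_eq_card m x hx.le]
  rcases lt_or_ge x 1 with hx1 | hx1
  · rw [Nat.floor_eq_zero.2 hx1]
    simp only [Icc_eq_empty_of_lt zero_lt_one, filter_empty, card_empty, Nat.cast_zero]
    positivity
  -- For m = 1, `Nat.minFac` is 1 and division by log 1 = 0 gives 0, so a = 2/3.
  set a := (2 : ℝ) / 3 + 1 / (25 * Real.log (m.minFac : ℝ)) with ha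
  have hcover : {n ∈ Icc 1 ⌊x⌋₊ | ¬ m ∣ (harmonic n).den} ⊆
      m.primeFactors.biUnion fun p =>
        {n ∈ Icc 1 ⌊x⌋₊ | ¬ p ^ m.factorization p ∣ (harmonic n).den} := fun n hn => by
    rw [mem_filter] at hn
    obtain ⟨p, hp, h⟩ := exists_primeFactor_not_ordProj_dvd hm.ne' (Rat.den_nz _) hn.2
    exact mem_biUnion.2 ⟨p, hp, mem_filter.2 ⟨hn.1, h⟩⟩
  have hprime : ∀ p ∈ m.primeFactors,
      (#{n ∈ Icc 1 ⌊x⌋₊ | ¬ p ^ m.factorization p ∣ (harmonic n).den} : ℝ) ≤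
        2 * x ^ a * ((p ^ m.factorization p : ℕ) : ℝ) ^ ((1 : ℝ) / 3) := fun p hp => by
    have hpp := Nat.prime_of_mem_primeFactors hp
    have : Fact p.Prime := ⟨hpp⟩
    have hm1 : m ≠ 1 := by
      rintro rfl
      simp at hp
    have hmin : (1 : ℝ) < m.minFac := by exact_mod_cast (Nat.minFac_prime hm1).one_lt
    have hlog : 0 < Real.log (m.minFac : ℝ) := log_pos hmin
    have hle : (m.minFac : ℝ) ≤ p := by
      exact_mod_cast Nat.minFac_le_of_dvd hpp.two_le (Nat.dvd_of_mem_primeFactors hp)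
    refine (card_not_prime_pow_dvd_den_le hx1).trans ?_
    -- As x ≥ 1 and the exponent decreases in p, the least prime factor is the worst case.
    rw [mul_right_comm, ha]
    gcongr
  calc (#{n ∈ Icc 1 ⌊x⌋₊ | ¬ m ∣ (harmonic n).den} : ℝ)
      ≤ ∑ p ∈ m.primeFactors,
          (#{n ∈ Icc 1 ⌊x⌋₊ | ¬ p ^ m.factorization p ∣ (harmonic n).den} : ℝ) := by
        exact_mod_cast (card_le_card hcover).trans card_biUnion_le
    _ ≤ ∑ p ∈ m.primeFactors,
          2 * x ^ a * ((p ^ m.factorization p : ℕ) : ℝ) ^ ((1 : ℝ) / 3) := sum_le_sum hprime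
    _ ≤ 2 * x ^ a * (2 * (m : ℝ) ^ ((1 : ℝ) / 3)) := by
        rw [← mul_sum]
        gcongr
        exact sum_ordProj_rpow_le m hm.ne'
    _ = 4 * (m : ℝ) ^ ((1 : ℝ) / 3) * x ^ a := by ring
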